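/- Let $D=(V,A)$ be a finite loopless digraph, let $V$ be partitioned into two nonempty subsets $S$ and $T$, and let $b\in\mathbb{Z}_{>0}^V$ be a positive integer vector on $V$. For $X\subseteq V$ let $\delta^-(X)$ (respectively $\delta^+(X)$) denote the set of arcs of $D$ entering (respectively leaving) $X$, write $\delta^{\pm}(v)=\delta^{\pm}(\{v\})$, and write $x(C)=\sum_{a\in C}x(a)$ for $x\in\mathbb{R}^A$ and $C\subseteq A$. A bicut is an arc set $C=\delta^-(U)$ with $\emptyset\ne U\subseteq T$ or $T\subseteq U\subsetneq V$. An arc set $B\subseteq A$ is a $b$-bibranching if in the subgraph $(V,B)$ every $v\in T$ is reachable from some vertex of $S$, every $u\in S$ reaches some vertex of $T$, every $v\in T$ is entered by at least $b(v)$ arcs of $B$, and every $u\in S$ is left by at least $b(u)$ arcs of $B$. The $b$-bibranching polytope is the convex hull in $\mathbb{R}^A$ of the characteristic vectors of the $b$-bibranchings. Then the linear system in $x\in\mathbb{R}^A$ \begin{align*} x(\delta^-(v)) &\ge b(v) && (v\in T),\\ x(\delta^+(v)) &\ge b(v) && (v\in S),\\ x(C) &\ge 1 && (C \text{ a bicut}),\\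 x(a) &\ge 0 && (a\in A),\\ x(a) &\le 1 && (a\in A) \end{align*} is totally dual integral, that is: writing the system as $Mx\ge r$, for each integer vector $c\in\mathbb{Z}^A$ for which the optimum in $\min\{c^\top x : Mx\ge r\}=\max\{y^\top r : y\ge 0,\ y^\top M=c^\top\}$ is finite, the maximum is attained by an integer vector $y$. Moreover, the $b$-bibranching polytope is exactly the set of solutions of this system. -/

import Mathlib

open scoped Matrix

/-- A loopless digraph with vertex set `V` and arc set `A` (parallel arcs are allowed). -/
structure ArcDigraph (V A : Type*) where
  /-- the initial vertex of an arc -/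
  tail : A → V
  /-- the terminal vertex of an arc -/
  head : A → V
  loopless : ∀ a, tail a ≠ head a

namespace ArcDigraph

variable {V A : Type*} [DecidableEq V] (D : ArcDigraph V A)

/-- The arcs of `B` that enter `X`. -/
def deltaIn (B : Finset A) (X : Finset V) : Finset A :=
  B.filter fun a => D.tail a ∉ X ∧ D.head a ∈ X

/-- The arcs of `B` that leave `X`. -/
def deltaOut (B : Finset A) (X : Finset V) : Finset A :=
  B.filter fun a => D.tail a ∈ X ∧ D.head a ∉ X

/-- `v` is reachable from `u` by a directed path (possibly of length `0`) in `(V, B)`. -/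
def Reaches (B : Finset A) (u v : V) : Prop :=
  Relation.ReflTransGen (fun x y => ∃ a ∈ B, D.tail a = x ∧ D.head a = y) u v

/-- `B` is a `b`-bibranching with respect to the partition `{S, T}` of the vertex set. -/
structure IsBBibranching (S T : Finset V) (b : V → ℕ) (B : Finset A) : Prop where
  reachable : ∀ v ∈ T, ∃ u ∈ S, D.Reaches B u v
  reaching : ∀ u ∈ S, ∃ v ∈ T, D.Reaches B u v
  le_inDegree : ∀ v ∈ T, b v ≤ (D.deltaIn B {v}).card
  le_outDegree : ∀ u ∈ S, b u ≤ (D.deltaOut B {u}).card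

variable [Fintype V] [Fintype A]

/-- A bicut: the set of arcs entering some `U` with `∅ ≠ U ⊆ T` or `T ⊆ U ⊊ V`. -/
def IsBicut (T : Finset V) (C : Finset A) : Prop :=
  ∃ U : Finset V, ((U.Nonempty ∧ U ⊆ T) ∨ (T ⊆ U ∧ U ≠ Finset.univ)) ∧
    C = D.deltaIn Finset.univ U

/-- The names of the inequalities of the linear system. -/
inductive Row (S T : Finset V) : Type _
  | inDegree (v : {v // v ∈ T})
  | outDegree (v : {v // v ∈ S})
  | bicut (C : {C : Finset A // D.IsBicut T C})
  | nonneg (a : A)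
  | leOne (a : A)

/-- The names of the inequalities as a disjoint union. -/
def rowEquiv (S T : Finset V) :
    D.Row S T ≃ {v // v ∈ T} ⊕ {v // v ∈ S} ⊕ {C : Finset A // D.IsBicut T C} ⊕ A ⊕ A where
  toFun
    | .inDegree v => .inl v
    | .outDegree v => .inr (.inl v)
    | .bicut C => .inr (.inr (.inl C))
    | .nonneg a => .inr (.inr (.inr (.inl a)))
    | .leOne a => .inr (.inr (.inr (.inr a)))
  invFun
    | .inl v => .inDegree v
    | .inr (.inl v) => .outDegree v
    | .inr (.inr (.inl C)) => .bicut C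
    | .inr (.inr (.inr (.inl a))) => .nonneg a
    | .inr (.inr (.inr (.inr a))) => .leOne a
  left_inv := by rintro (_ | _ | _ | _ | _) <;> rfl
  right_inv := by rintro (_ | _ | _ | _ | _) <;> rfl

open scoped Classical in
noncomputable instance (S T : Finset V) : Fintype (D.Row S T) :=
  Fintype.ofEquiv _ (D.rowEquiv S T).symm

end ArcDigraph

/-- The characteristic vector of a finite set. -/
def charVec {A : Type*} [DecidableEq A] (B : Finset A) : A → ℝ :=
  fun a => if a ∈ B then 1 else 0

namespace ArcDigraph

variable {V A : Type*} [DecidableEq V] [DecidableEq A] [Fintype V] [Fintype A]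
  (D : ArcDigraph V A)

/-- The left-hand sides of the linear system, written as `M x ≥ r`; in particular `x(a) ≤ 1`
is written as `-x(a) ≥ -1`. -/
def rowMatrix (S T : Finset V) : Matrix (D.Row S T) A ℝ
  | .inDegree v => charVec (D.deltaIn Finset.univ {v.1})
  | .outDegree v => charVec (D.deltaOut Finset.univ {v.1})
  | .bicut C => charVec C.1
  | .nonneg a => charVec {a}
  | .leOne a => -charVec {a}

/-- The right-hand sides of the linear system. -/
def rowRhs (S T : Finset V) (b : V → ℕ) : D.Row S T → ℝ
  | .inDegree v => b v.1
  | .outDegree v => b v.1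
  | .bicut _ => 1
  | .nonneg _ => 0
  | .leOne _ => -1

/-- The `b`-bibranching polytope: the convex hull of the characteristic vectors of the
`b`-bibranchings. -/
def bBibranchingPolytope (S T : Finset V) (b : V → ℕ) : Set (A → ℝ) :=
  convexHull ℝ {x | ∃ B : Finset A, D.IsBBibranching S T b B ∧ x = charVec B}

end ArcDigraph

/-- The solution set of the linear system `M x ≥ r`. -/
def solutionSet {ι α : Type*} [Fintype α] (M : Matrix ι α ℝ) (r : ι → ℝ) : Set (α → ℝ) :=
  {x | ∀ i, r i ≤ (M *ᵥ x) i}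

/-- The feasible region of the linear program `max {y r : y ≥ 0, y M = c}`, which is the dual of
`min {c x : M x ≥ r}`. -/
def dualFeasible {ι α : Type*} [Fintype ι] (M : Matrix ι α ℝ) (c : α → ℝ) : Set (ι → ℝ) :=
  {y | (∀ i, 0 ≤ y i) ∧ y ᵥ* M = c}

/-- The system `M x ≥ r` is totally dual integral: for each integer vector `c` for which the
optimum in `min {c x : M x ≥ r} = max {y r : y ≥ 0, y M = c}` is finite, the maximum is attained
by an integer vector. -/
def IsTDI {ι α : Type*} [Fintype ι] (M : Matrix ι α ℝ) (r : ι → ℝ) : Prop :=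
  ∀ c : α → ℤ,
    (dualFeasible M fun a => (c a : ℝ)).Nonempty →
    BddAbove ((fun y : ι → ℝ => y ⬝ᵥ r) '' dualFeasible M fun a => (c a : ℝ)) →
    ∃ z : ι → ℤ, (fun i => (z i : ℝ)) ∈ dualFeasible M (fun a => (c a : ℝ)) ∧
      ∀ y ∈ dualFeasible M (fun a => (c a : ℝ)), y ⬝ᵥ r ≤ (fun i => (z i : ℝ)) ⬝ᵥ r

/-! Dual side. A dual solution amounts to nonnegative weights on the nonempty subsets of `T` (arcs
entering) and of `S` (arcs leaving), each set worth `demand b`, together with weights on arcs that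
pay for coverage beyond the cost `c`. A singleton may have a large demand, but it never crosses
another set, so `demand b` is supermodular on crossing pairs. Hence each of the two families can be
uncrossed to a laminar one without raising any coverage or lowering the value
(`exists_laminarSupport`).

In a laminar family the members containing a given nonempty set form a chain. Rounding partial sums
along these chains telescopes: the coverage of an arc, a difference of two partial sums, becomes the
difference of the rounded sums (`coverage_roundAlong`). With `⌊x + θ⌋` on `T` and its mirror image
`-⌊θ - x⌋` on `S`, every coverage `β - α` turns into `⌊β + θ⌋ - ⌊α + θ⌋` for one common shift `θ`.
The weights of the sets and, because `c` is integral, the excesses over `c` have the same form. The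
mean of such an expression over `θ ∈ [0,1]` is `β - α`, so some `θ` gives integral weights of no
smaller value (`exists_integral_weights`). Values of integral dual solutions are integers bounded
above, so a best one exists, and it dominates every real dual solution.

Primal side. Total dual integrality with integral data forces integral extreme points
(`IsTDI.extremePoints_integral`). The region lies in the unit cube, so its extreme points are 0-1
vectors, and the 0-1 solutions are the `b`-bibranchings. Krein–Milman finishes the proof. -/

/-- The total weight of the members of a weighted set family that contain `h` but not `t`. -/
def coverage {V R : Type*} [Fintype V] [DecidableEq V] [NonAssocSemiring R]
    (y : Finset V → R) (t h : V) : R :=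
  ∑ X, y X * (if h ∈ X ∧ t ∉ X then 1 else 0)

/-- The total weight of the members of a weighted set family that contain `Q`. -/
def weightAbove {V R : Type*} [Fintype V] [DecidableEq V] [AddCommMonoid R]
    (y : Finset V → R) (Q : Finset V) : R :=
  ∑ X with Q ⊆ X, y X

/-- The support of `y` is a laminar family. -/
def LaminarSupport {V R : Type*} [DecidableEq V] [Zero R] (y : Finset V → R) : Prop :=
  ∀ X Y, y X ≠ 0 → y Y ≠ 0 → X ⊆ Y ∨ Y ⊆ X ∨ Disjoint X Y

/-- The nonempty subsets of `P` carry all the weight of `y`. -/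
def SupportedOn {V R : Type*} [Zero R] (P : Finset V) (y : Finset V → R) : Prop :=
  ∀ X, y X ≠ 0 → X.Nonempty ∧ X ⊆ P

/-! ### Uncrossing to a laminar family -/

section Uncrossing

variable {V : Type*} [DecidableEq V]

/-- Move weight `ε` from `X` and `Y` to their intersection and union. -/
def uncross (y : Finset V → ℝ) (ε : ℝ) (X Y : Finset V) : Finset V → ℝ :=
  y + ε • (Pi.single (X ∩ Y) 1 + Pi.single (X ∪ Y) 1 - Pi.single X 1 - Pi.single Y 1)

lemma sum_uncross_mul [Fintype V] (y : Finset V → ℝ) (ε : ℝ) (X Y : Finset V) (g : Finset V → ℝ) :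
    ∑ Z, uncross y ε X Y Z * g Z =
      ∑ Z, y Z * g Z + ε * (g (X ∩ Y) + g (X ∪ Y) - g X - g Y) := by
  simp only [uncross, Pi.add_apply, Pi.smul_apply, Pi.sub_apply, smul_eq_mul, add_mul,
    Finset.sum_add_distrib, mul_assoc, ← Finset.mul_sum, sub_mul, Finset.sum_sub_distrib]
  simp [Pi.single_apply]

/-- Submodularity of cuts: this is why uncrossing never increases a coverage. -/
lemma indicator_uncross_le (X Y : Finset V) (t h : V) :
    (if h ∈ X ∩ Y ∧ t ∉ X ∩ Y then (1 : ℝ) else 0) + (if h ∈ X ∪ Y ∧ t ∉ X ∪ Y then 1 else 0)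
      - (if h ∈ X ∧ t ∉ X then 1 else 0) - (if h ∈ Y ∧ t ∉ Y then 1 else 0) ≤ 0 := by
  by_cases h1 : h ∈ X <;> by_cases h2 : h ∈ Y <;> by_cases h3 : t ∈ X <;> by_cases h4 : t ∈ Y <;>
    simp [h1, h2, h3, h4]

/-- Strict convexity of the square: intersection and union have the same total size as the pair but
are more spread out. This is the potential that uncrossing increases. -/
lemma card_sq_lt_of_crossing {X Y : Finset V} (h1 : ¬ X ⊆ Y) (h2 : ¬ Y ⊆ X) :
    (X.card : ℝ) ^ 2 + (Y.card : ℝ) ^ 2 < ((X ∩ Y).card : ℝ) ^ 2 + ((X ∪ Y).card : ℝ) ^ 2 := by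
  have e1 : (X \ Y).card + (X ∩ Y).card = X.card := Finset.card_sdiff_add_card_inter X Y
  have e2 : (Y \ X).card + (X ∩ Y).card = Y.card := by
    rw [Finset.inter_comm]; exact Finset.card_sdiff_add_card_inter Y X
  have e3 : (X ∪ Y).card + (X ∩ Y).card = X.card + Y.card := Finset.card_union_add_card_inter X Y
  have p1 : 0 < (X \ Y).card := Finset.card_pos.2 (Finset.sdiff_nonempty.2 h1)
  have p2 : 0 < (Y \ X).card := Finset.card_pos.2 (Finset.sdiff_nonempty.2 h2)
  have e4 : (X ∪ Y).card = (X \ Y).card + (Y \ X).card + (X ∩ Y).card := by omega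
  rw [← e1, ← e2, e4]
  push_cast
  have : (0 : ℝ) < ((X \ Y).card : ℝ) * ((Y \ X).card : ℝ) := by positivity
  nlinarith

/-- A nonnegative weighting of the nonempty subsets of `P` can be uncrossed to a laminar one, for an
intersecting supermodular objective `f`. -/
lemma exists_laminarSupport [Fintype V] (P : Finset V) (f : Finset V → ℝ)
    (hf : ∀ X Y, ¬ X ⊆ Y → ¬ Y ⊆ X → ¬ Disjoint X Y → f X + f Y ≤ f (X ∩ Y) + f (X ∪ Y))
    (y₀ : Finset V → ℝ) (h₀ : ∀ X, 0 ≤ y₀ X) (hs₀ : SupportedOn P y₀) :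
    ∃ y : Finset V → ℝ, (∀ X, 0 ≤ y X) ∧ SupportedOn P y ∧ LaminarSupport y ∧
      (∀ t h, coverage y t h ≤ coverage y₀ t h) ∧ ∑ X, y₀ X * f X ≤ ∑ X, y X * f X := by
  -- Uncrossing preserves the total size. Bounding it by its initial value `C` makes `K` compact,
  -- since supporting sets have at least one element.
  let C : ℝ := ∑ X, y₀ X * X.card
  let K : Set (Finset V → ℝ) := {y | (∀ X, 0 ≤ y X) ∧ (∀ X, ¬ (X.Nonempty ∧ X ⊆ P) → y X = 0) ∧
    (∀ t h, coverage y t h ≤ coverage y₀ t h) ∧ ∑ X, y₀ X * f X ≤ ∑ X, y X * f X ∧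
    ∑ X, y X * X.card ≤ C}
  have hK₀ : y₀ ∈ K :=
    ⟨h₀, fun X hX => by_contra fun h => hX (hs₀ X h), fun _ _ => le_rfl, le_rfl, le_rfl⟩
  have hclosed : IsClosed K := by
    refine IsClosed.inter (s₁ := {y | ∀ X, 0 ≤ y X}) ?_ (IsClosed.inter
      (s₁ := {y | ∀ X, ¬ (X.Nonempty ∧ X ⊆ P) → y X = 0}) ?_ (IsClosed.inter
      (s₁ := {y | ∀ t h, coverage y t h ≤ coverage y₀ t h}) ?_ (IsClosed.inter
      (s₁ := {y | ∑ X, y₀ X * f X ≤ ∑ X, y X * f X}) ?_ ?_)))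
    · simp only [Set.ofPred_forall]
      exact isClosed_iInter fun X => isClosed_le continuous_const (continuous_apply X)
    · simp only [Set.ofPred_forall]
      exact isClosed_iInter fun X => isClosed_iInter fun _ =>
        isClosed_eq (continuous_apply X) continuous_const
    · simp only [Set.ofPred_forall, coverage]
      exact isClosed_iInter fun t => isClosed_iInter fun h =>
        isClosed_le (by fun_prop) continuous_const
    · exact isClosed_le continuous_const
        (continuous_finsetSum _ fun X _ => (continuous_apply X).mul continuous_const)
    · exact isClosed_le (continuous_finsetSum _ fun X _ => (continuous_apply X).mul continuous_const)
        continuous_const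
  have hsub : K ⊆ Set.Icc 0 (fun _ => C) := by
    rintro y ⟨h1, h2, -, -, h5⟩
    refine ⟨h1, fun X => ?_⟩
    have hC : 0 ≤ C := Finset.sum_nonneg fun X _ => mul_nonneg (h₀ X) (Nat.cast_nonneg _)
    by_cases hX : X.Nonempty ∧ X ⊆ P
    · have hc : (1 : ℝ) ≤ X.card := by exact_mod_cast Finset.card_pos.2 hX.1
      calc y X ≤ y X * X.card := le_mul_of_one_le_right (h1 X) hc
        _ ≤ ∑ X, y X * X.card := Finset.single_le_sum (f := fun X => y X * (X.card : ℝ))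
            (fun X _ => mul_nonneg (h1 X) (Nat.cast_nonneg _)) (Finset.mem_univ X)
        _ ≤ C := h5
    · rw [h2 X hX]; exact hC
  have hcomp : IsCompact K := isCompact_Icc.of_isClosed_subset hclosed hsub
  -- Real weights give no obvious termination of repeated uncrossing, so a maximizer of the
  -- potential is taken instead. Uncrossing a remaining crossing pair would stay in `K` and exceed
  -- the maximum.
  obtain ⟨y, hyK, hmax⟩ := hcomp.exists_isMaxOn ⟨y₀, hK₀⟩
    (f := fun y : Finset V → ℝ => ∑ X, y X * (X.card : ℝ) ^ 2) (by fun_prop)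
  obtain ⟨h1, h2, h3, h4, h5⟩ := hyK
  have hsupp : SupportedOn P y := fun X hX => by_contra fun h => hX (h2 X h)
  refine ⟨y, h1, hsupp, ?_, h3, h4⟩
  intro X Y hX hY
  by_contra! hcon
  obtain ⟨c1, c2, c3⟩ := hcon
  have hX' : 0 < y X := lt_of_le_of_ne (h1 X) hX.symm
  have hY' : 0 < y Y := lt_of_le_of_ne (h1 Y) hY.symm
  obtain ⟨ε, hε, hεX, hεY⟩ : ∃ ε, 0 < ε ∧ ε ≤ y X ∧ ε ≤ y Y :=
    ⟨min (y X) (y Y), lt_min hX' hY', min_le_left _ _, min_le_right _ _⟩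
  have hXY : X ≠ Y := fun h => c1 (h ▸ subset_rfl)
  have hK : uncross y ε X Y ∈ K := by
    refine ⟨fun Z => ?_, fun Z hZ => ?_, fun t h => ?_, ?_, ?_⟩
    · have hpos : ∀ W : Finset V, (0 : ℝ) ≤ (Pi.single W (1 : ℝ) : Finset V → ℝ) Z := by
        intro W; rw [Pi.single_apply]; split_ifs <;> norm_num
      have key : 0 ≤ y Z - ε * ((Pi.single X (1 : ℝ) : Finset V → ℝ) Z +
          (Pi.single Y (1 : ℝ) : Finset V → ℝ) Z) := by
        rw [Pi.single_apply, Pi.single_apply]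
        by_cases e1 : Z = X
        · subst e1; simpa [hXY] using hεX
        · by_cases e2 : Z = Y
          · subst e2; simpa [e1] using hεY
          · simpa [e1, e2] using h1 Z
      simp only [uncross, Pi.add_apply, Pi.smul_apply, Pi.sub_apply, smul_eq_mul]
      nlinarith [mul_nonneg hε.le (hpos (X ∩ Y)), mul_nonneg hε.le (hpos (X ∪ Y))]
    · obtain ⟨n1, n2⟩ := hsupp X hX
      obtain ⟨m1, m2⟩ := hsupp Y hY
      have e1 : Z ≠ X := by rintro rfl; exact hZ ⟨n1, n2⟩
      have e2 : Z ≠ Y := by rintro rfl; exact hZ ⟨m1, m2⟩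
      have e3 : Z ≠ X ∩ Y := by
        rintro rfl
        exact hZ ⟨Finset.not_disjoint_iff_nonempty_inter.1 c3, Finset.inter_subset_left.trans n2⟩
      have e4 : Z ≠ X ∪ Y := by
        rintro rfl
        exact hZ ⟨n1.mono Finset.subset_union_left, Finset.union_subset n2 m2⟩
      simp [uncross, e1, e2, e3, e4, h2 Z hZ]
    · refine le_trans ?_ (h3 t h)
      rw [coverage, sum_uncross_mul, coverage]
      have := mul_nonneg hε.le (neg_nonneg.2 (indicator_uncross_le X Y t h))
      linarith
    · rw [sum_uncross_mul]
      have := mul_nonneg hε.le (sub_nonneg.2 (hf X Y c1 c2 c3))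
      linarith
    · rw [sum_uncross_mul]
      have : ((X ∪ Y).card : ℝ) + (X ∩ Y).card = X.card + Y.card := by
        exact_mod_cast Finset.card_union_add_card_inter X Y
      have e : ((X ∩ Y).card : ℝ) + (X ∪ Y).card - X.card - Y.card = 0 := by linarith
      rw [e]; linarith
  have hle : ∑ Z, uncross y ε X Y Z * (Z.card : ℝ) ^ 2 ≤ ∑ Z, y Z * (Z.card : ℝ) ^ 2 := hmax hK
  rw [sum_uncross_mul] at hle
  have := mul_pos hε (sub_pos.2 (card_sq_lt_of_crossing c1 c2))
  linarith

end Uncrossing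

/-! ### Rounding along the chains of a laminar family -/

section Rounding

variable {V : Type*} [Fintype V] [DecidableEq V]

lemma coverage_eq_sub {R : Type*} [NonAssocRing R] (y : Finset V → R) (t h : V) :
    coverage y t h = weightAbove y {h} - weightAbove y {t, h} := by
  simp only [coverage, weightAbove, Finset.sum_filter, ← Finset.sum_sub_distrib]
  refine Finset.sum_congr rfl fun X _ => ?_
  by_cases h1 : h ∈ X <;> by_cases h2 : t ∈ X <;> simp [h1, h2, Finset.insert_subset_iff]

lemma weightAbove_eq_zero {R : Type*} [AddCommMonoid R] {P : Finset V} {y : Finset V → R}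
    (hy : SupportedOn P y) {Q : Finset V} (hQ : ¬ Q ⊆ P) : weightAbove y Q = 0 := by
  refine Finset.sum_eq_zero fun X hX => by_contra fun h => hQ ?_
  exact (Finset.mem_filter.1 hX).2.trans (hy X h).2

/-- Round the partial sums of `y` along the chains of its support by `ρ`. -/
noncomputable def roundAlong (ρ : ℝ → ℤ) (y : Finset V → ℝ) (X : Finset V) : ℤ :=
  ρ (weightAbove y X) - ρ (weightAbove y X - y X)

lemma roundAlong_of_eq_zero (ρ : ℝ → ℤ) {y : Finset V → ℝ} {X : Finset V} (h : y X = 0) :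
    roundAlong ρ y X = 0 := by
  simp [roundAlong, h]

lemma roundAlong_nonneg {ρ : ℝ → ℤ} (hρ : Monotone ρ) {y : Finset V → ℝ} (hy : ∀ X, 0 ≤ y X)
    (X : Finset V) : 0 ≤ roundAlong ρ y X :=
  sub_nonneg.2 (hρ (sub_le_self _ (hy X)))

lemma SupportedOn.roundAlong {P : Finset V} {y : Finset V → ℝ} (hy : SupportedOn P y)
    (ρ : ℝ → ℤ) : SupportedOn P (roundAlong ρ y) :=
  fun X hX => hy X fun h => hX (roundAlong_of_eq_zero ρ h)

/-- A telescoping sum: by laminarity the sets in `𝒞` form a chain, as all contain the nonempty `Q`.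
Induction strips off the smallest set, whose upper partial sum is the whole sum over `𝒞`. -/
lemma sum_roundAlong_of_upClosed (ρ : ℝ → ℤ) {y : Finset V → ℝ} (hy : LaminarSupport y)
    {Q : Finset V} (hQ : Q.Nonempty) (𝒞 : Finset (Finset V))
    (h1 : ∀ X ∈ 𝒞, y X ≠ 0 ∧ Q ⊆ X)
    (h2 : ∀ X ∈ 𝒞, ∀ Y, X ⊆ Y → y Y ≠ 0 → Y ∈ 𝒞) :
    ∑ X ∈ 𝒞, roundAlong ρ y X = ρ (∑ X ∈ 𝒞, y X) - ρ 0 := by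
  induction 𝒞 using Finset.strongInduction with
  | H 𝒞 ih =>
    rcases 𝒞.eq_empty_or_nonempty with rfl | hne
    · simp
    obtain ⟨X₀, hX₀, hmin⟩ := 𝒞.exists_min_image Finset.card hne
    have hbot : ∀ X ∈ 𝒞, X₀ ⊆ X := by
      intro X hX
      rcases hy X₀ X (h1 _ hX₀).1 (h1 _ hX).1 with h | h | h
      · exact h
      · exact (Finset.eq_of_subset_of_card_le h (hmin X hX)).ge
      · obtain ⟨q, hq⟩ := hQ
        exact absurd ((h1 _ hX).2 hq) (Finset.disjoint_left.1 h ((h1 _ hX₀).2 hq))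
    have hsum : weightAbove y X₀ = ∑ X ∈ 𝒞, y X := by
      symm
      refine Finset.sum_subset (fun X hX => by simpa using hbot X hX) fun X hX hX' => ?_
      by_contra hne
      exact hX' (h2 X₀ hX₀ X (by simpa using hX) hne)
    have herase := ih (𝒞.erase X₀) (Finset.erase_ssubset hX₀)
      (fun X hX => h1 X (Finset.mem_of_mem_erase hX)) fun X hX Y hXY hY => by
        refine Finset.mem_erase.2 ⟨?_, h2 X (Finset.mem_of_mem_erase hX) Y hXY hY⟩
        rintro rfl
        exact Finset.ne_of_mem_erase hX (hXY.antisymm (hbot X (Finset.mem_of_mem_erase hX)))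
    have e := Finset.add_sum_erase 𝒞 y hX₀
    rw [← Finset.add_sum_erase _ _ hX₀, herase, roundAlong, hsum, ← e]
    simp

lemma weightAbove_roundAlong (ρ : ℝ → ℤ) {y : Finset V → ℝ} (hy : LaminarSupport y)
    {Q : Finset V} (hQ : Q.Nonempty) :
    weightAbove (roundAlong ρ y) Q = ρ (weightAbove y Q) - ρ 0 := by
  have h := sum_roundAlong_of_upClosed ρ hy hQ (Finset.univ.filter fun X => Q ⊆ X ∧ y X ≠ 0)
    (fun X hX => by simpa [and_comm] using hX) fun X hX Y hXY hY => by
      simp only [Finset.mem_filter, Finset.mem_univ, true_and] at hX ⊢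
      exact ⟨hX.1.trans hXY, hY⟩
  have e1 : weightAbove y Q = ∑ X with Q ⊆ X ∧ y X ≠ 0, y X := by
    rw [weightAbove, ← Finset.filter_filter, Finset.sum_filter_ne_zero]
  have e2 : weightAbove (roundAlong ρ y) Q = ∑ X with Q ⊆ X ∧ y X ≠ 0, roundAlong ρ y X := by
    rw [weightAbove, ← Finset.filter_filter]
    refine (Finset.sum_filter_of_ne (p := fun X => y X ≠ 0) fun X _ hX h => hX (roundAlong_of_eq_zero ρ h)).symm
  rw [e1, e2, h]

lemma coverage_roundAlong (ρ : ℝ → ℤ) {y : Finset V → ℝ} (hy : LaminarSupport y) (t h : V) :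
    coverage (roundAlong ρ y) t h = ρ (weightAbove y {h}) - ρ (weightAbove y {t, h}) := by
  rw [coverage_eq_sub, weightAbove_roundAlong ρ hy (by simp), weightAbove_roundAlong ρ hy (by simp)]
  ring

end Rounding

/-! ### Averaging over a common shift -/

section Averaging

lemma intervalIntegrable_floor (β : ℝ) :
    IntervalIntegrable (fun θ : ℝ => (⌊β + θ⌋ : ℝ)) MeasureTheory.volume 0 1 :=
  Monotone.intervalIntegrable fun x y h => by
    have : ⌊β + x⌋ ≤ ⌊β + y⌋ := Int.floor_le_floor (by linarith)
    exact_mod_cast this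

lemma integral_floor (β : ℝ) : ∫ θ in (0 : ℝ)..1, (⌊β + θ⌋ : ℝ) = β := by
  have h0 : 0 ≤ Int.fract β := Int.fract_nonneg β
  have h1 : Int.fract β < 1 := Int.fract_lt_one β
  have hβ : β = ⌊β⌋ + Int.fract β := (Int.floor_add_fract β).symm
  -- The shift at which `⌊β + θ⌋` jumps from `⌊β⌋` to `⌊β⌋ + 1`.
  set s := 1 - Int.fract β with hs
  have i1 : IntervalIntegrable (fun θ : ℝ => (⌊β + θ⌋ : ℝ)) MeasureTheory.volume 0 s :=
    (intervalIntegrable_floor β).mono_set (by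
      rw [Set.uIcc_of_le (by linarith), Set.uIcc_of_le (by linarith)]
      exact Set.Icc_subset_Icc_right (by linarith))
  have i2 : IntervalIntegrable (fun θ : ℝ => (⌊β + θ⌋ : ℝ)) MeasureTheory.volume s 1 :=
    (intervalIntegrable_floor β).mono_set (by
      rw [Set.uIcc_of_le (by linarith), Set.uIcc_of_le (by linarith)]
      exact Set.Icc_subset_Icc_left (by linarith))
  have e1 : ∫ θ in (0 : ℝ)..s, (⌊β + θ⌋ : ℝ) = ∫ θ in (0 : ℝ)..s, (⌊β⌋ : ℝ) := by
    refine intervalIntegral.integral_congr_Ioo_of_le (by linarith) fun θ hθ => ?_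
    have : ⌊β + θ⌋ = ⌊β⌋ := Int.floor_eq_iff.2 ⟨by linarith [hθ.1], by linarith [hθ.2]⟩
    simp [this]
  have e2 : ∫ θ in s..1, (⌊β + θ⌋ : ℝ) = ∫ θ in s..1, ((⌊β⌋ : ℝ) + 1) := by
    refine intervalIntegral.integral_congr_Ioo_of_le (by linarith) fun θ hθ => ?_
    have : ⌊β + θ⌋ = ⌊β⌋ + 1 := Int.floor_eq_iff.2
      ⟨by push_cast; linarith [hθ.1], by push_cast; linarith [hθ.2]⟩
    simp [this]
  rw [← intervalIntegral.integral_add_adjacent_intervals i1 i2, e1, e2]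
  simp only [intervalIntegral.integral_const, smul_eq_mul]
  rw [hs]; nlinarith

/-- The integer obtained from `β - α` by shifting `α` and `β` by `θ` and rounding both down. -/
noncomputable def floorDiff (α β θ : ℝ) : ℤ := ⌊β + θ⌋ - ⌊α + θ⌋

lemma intervalIntegrable_floorDiff (α β : ℝ) :
    IntervalIntegrable (fun θ : ℝ => (floorDiff α β θ : ℝ)) MeasureTheory.volume 0 1 := by
  simp only [floorDiff, Int.cast_sub]
  exact (intervalIntegrable_floor β).sub (intervalIntegrable_floor α)

lemma integral_floorDiff (α β : ℝ) : ∫ θ in (0 : ℝ)..1, (floorDiff α β θ : ℝ) = β - α := by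
  simp only [floorDiff, Int.cast_sub]
  rw [intervalIntegral.integral_sub (intervalIntegrable_floor β) (intervalIntegrable_floor α),
    integral_floor, integral_floor]

/-- Rounding respects integer thresholds: the excess over an integer is rounded consistently. -/
lemma exists_excess_eq_floorDiff (α β : ℝ) (c : ℤ) :
    ∃ α' β' : ℝ, max 0 (β - α - c) = β' - α' ∧
      ∀ θ, max 0 (floorDiff α β θ - c) = floorDiff α' β' θ := by
  -- Floors are monotone and commute with adding the integer `c`, so the sign of the excess survives
  -- rounding for every `θ`. The excess is either identically zero or obtained by replacing `α` with
  -- `α + c`.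
  rcases le_total (β - α) c with h | h
  · refine ⟨0, 0, by simp [h], fun θ => ?_⟩
    have : ⌊β + θ⌋ ≤ ⌊α + θ⌋ + c := by
      rw [← Int.floor_add_intCast]; exact Int.floor_le_floor (by linarith)
    rw [max_eq_left (by unfold floorDiff; omega)]; simp [floorDiff]
  · refine ⟨α + c, β, by rw [max_eq_right (by linarith)]; ring, fun θ => ?_⟩
    have e : ⌊α + c + θ⌋ = ⌊α + θ⌋ + c := by
      rw [← Int.floor_add_intCast]; congr 1; ring
    have : ⌊α + θ⌋ + c ≤ ⌊β + θ⌋ := by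
      rw [← e]; exact Int.floor_le_floor (by linarith)
    rw [max_eq_right (by unfold floorDiff; omega)]; unfold floorDiff; omega

/-- Some shift makes a linear function of simultaneously rounded differences at least as large as
its unrounded value. -/
lemma exists_sum_le_sum_floorDiff {ι : Type*} [Fintype ι] (w α β : ι → ℝ) :
    ∃ θ : ℝ, ∑ i, w i * (β i - α i) ≤ ∑ i, w i * (floorDiff (α i) (β i) θ : ℝ) := by
  by_contra! hcon
  have hint : ∀ i ∈ Finset.univ, IntervalIntegrable
      (fun θ : ℝ => w i * (floorDiff (α i) (β i) θ : ℝ)) MeasureTheory.volume 0 1 :=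
    fun i _ => (intervalIntegrable_floorDiff _ _).const_mul _
  have hsum : IntervalIntegrable (fun θ : ℝ => ∑ i, w i * (floorDiff (α i) (β i) θ : ℝ))
      MeasureTheory.volume 0 1 := by
    simpa only [Finset.sum_fn] using IntervalIntegrable.sum Finset.univ hint
  -- If every shift lost value, the loss would have positive integral; but both sides have the same
  -- mean.
  have h := intervalIntegral.intervalIntegral_pos_of_pos
    (intervalIntegrable_const (c := ∑ i, w i * (β i - α i)) |>.sub hsum)
    (fun θ => sub_pos.2 (hcon θ)) one_pos
  rw [intervalIntegral.integral_sub intervalIntegrable_const hsum,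
    intervalIntegral.integral_finsetSum hint] at h
  simp [intervalIntegral.integral_const_mul, integral_floorDiff] at h

end Averaging

/-! ### Demands of cuts -/

/-- The right-hand side of the inequality for the cut given by `X`. -/
def demand {V : Type*} (b : V → ℕ) (X : Finset V) : ℝ :=
  if X.card = 1 then ∑ v ∈ X, (b v : ℝ) else 1

section Demand

variable {V : Type*} {b : V → ℕ}

lemma demand_singleton (v : V) : demand b {v} = b v := by simp [demand]

lemma demand_of_card_ne_one {X : Finset V} (h : X.card ≠ 1) : demand b X = 1 := by
  simp [demand, h]

lemma one_le_demand (hb : ∀ v, 0 < b v) (X : Finset V) : 1 ≤ demand b X := by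
  unfold demand
  split_ifs with h
  · obtain ⟨v, rfl⟩ := Finset.card_eq_one.1 h
    simpa using Nat.one_le_iff_ne_zero.2 (hb v).ne'
  · exact le_rfl

lemma card_ne_one_of_crossing {X Y : Finset V} (h1 : ¬ X ⊆ Y) (h2 : ¬ Disjoint X Y) :
    X.card ≠ 1 := by
  intro h
  obtain ⟨v, rfl⟩ := Finset.card_eq_one.1 h
  simp only [Finset.singleton_subset_iff, Finset.disjoint_singleton_left] at h1 h2
  exact h2 h1

/-- Crossing sets are not singletons, so the left side is `1 + 1`; on the right every demand is at
least `1`. -/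
lemma demand_supermodular [DecidableEq V] (hb : ∀ v, 0 < b v) (X Y : Finset V) (h1 : ¬ X ⊆ Y)
    (h2 : ¬ Y ⊆ X) (h3 : ¬ Disjoint X Y) :
    demand b X + demand b Y ≤ demand b (X ∩ Y) + demand b (X ∪ Y) := by
  rw [demand_of_card_ne_one (card_ne_one_of_crossing h1 h3),
    demand_of_card_ne_one (card_ne_one_of_crossing h2 fun h => h3 h.symm)]
  exact add_le_add (one_le_demand hb _) (one_le_demand hb _)

end Demand

/-! ### Simultaneous rounding of the two laminar families -/

section IntegralWeights

variable {V : Type*} [Fintype V] [DecidableEq V]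

/-- The coverages of an arc from `t` to `h` by a laminar family on `T` and by a laminar family on
`S` round together to a single difference of shifted integer parts. -/
lemma exists_coverage_eq_floorDiff {S T : Finset V} (hST : Disjoint S T)
    (hcover : S ∪ T = Finset.univ) {yT yS : Finset V → ℝ} (hT : SupportedOn T yT)
    (hS : SupportedOn S yS) (lT : LaminarSupport yT) (lS : LaminarSupport yS) (t h : V) :
    ∃ α β : ℝ, coverage yT t h + coverage yS h t = β - α ∧
      ∀ θ : ℝ, coverage (roundAlong (fun x => ⌊x + θ⌋) yT) t h +
        coverage (roundAlong (fun x => -⌊θ - x⌋) yS) h t = floorDiff α β θ := by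
  simp only [coverage_roundAlong _ lT, coverage_roundAlong _ lS, coverage_eq_sub, floorDiff]
  have mem : ∀ v, v ∈ S ∨ v ∈ T := fun v => by
    rw [← Finset.mem_union, hcover]; exact Finset.mem_univ v
  have notS : ∀ v ∈ T, v ∉ S := fun v hv hv' => Finset.disjoint_left.1 hST hv' hv
  have notT : ∀ v ∈ S, v ∉ T := fun v hv hv' => Finset.disjoint_left.1 hST hv hv'
  -- Only arcs from `S` to `T` can be covered by both families. There the mirrored rounding on `S`
  -- makes the two `⌊θ⌋` terms cancel, leaving `⌊β + θ⌋ - ⌊α + θ⌋` with `β` from `T` and `-α` from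
  -- `S`.
  rcases mem t with ht | ht <;> rcases mem h with hh | hh
  · rw [weightAbove_eq_zero hT (Q := {h}) (by simpa using notT h hh),
      weightAbove_eq_zero hT (Q := {t, h}) (by simp [Finset.insert_subset_iff, notT h hh])]
    exact ⟨-weightAbove yS {t}, -weightAbove yS {h, t}, by ring, fun θ => by
      rw [neg_add_eq_sub, neg_add_eq_sub]; ring⟩
  · rw [weightAbove_eq_zero hT (Q := {t, h}) (by simp [Finset.insert_subset_iff, notT t ht]),
      weightAbove_eq_zero hS (Q := {h, t}) (by simp [Finset.insert_subset_iff, notS h hh])]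
    exact ⟨-weightAbove yS {t}, weightAbove yT {h}, by ring, fun θ => by
      rw [neg_add_eq_sub, zero_add, sub_zero]; ring⟩
  · rw [weightAbove_eq_zero hT (Q := {h}) (by simpa using notT h hh),
      weightAbove_eq_zero hT (Q := {t, h}) (by simp [Finset.insert_subset_iff, notT h hh]),
      weightAbove_eq_zero hS (Q := {t}) (by simpa using notS t ht),
      weightAbove_eq_zero hS (Q := {h, t}) (by simp [Finset.insert_subset_iff, notS t ht])]
    exact ⟨0, 0, by ring, fun θ => by ring⟩
  · rw [weightAbove_eq_zero hS (Q := {t}) (by simpa using notS t ht),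
      weightAbove_eq_zero hS (Q := {h, t}) (by simp [Finset.insert_subset_iff, notS t ht])]
    exact ⟨weightAbove yT {t, h}, weightAbove yT {h}, by ring, fun θ => by ring⟩

/-- Every weighting of the cuts and of the upper bounds that respects the integral costs `c` is
dominated by an integral one. -/
lemma exists_integral_weights {A : Type*} [Fintype A] (D : ArcDigraph V A) {S T : Finset V}
    (hST : Disjoint S T) (hcover : S ∪ T = Finset.univ) {b : V → ℕ} (hb : ∀ v, 0 < b v)
    (c : A → ℤ) {yT yS : Finset V → ℝ} {w : A → ℝ} (pT : ∀ X, 0 ≤ yT X) (pS : ∀ X, 0 ≤ yS X)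
    (pw : ∀ a, 0 ≤ w a) (hT : SupportedOn T yT) (hS : SupportedOn S yS)
    (hc : ∀ a, coverage yT (D.tail a) (D.head a) + coverage yS (D.head a) (D.tail a) ≤ c a + w a) :
    ∃ (zT zS : Finset V → ℤ) (u : A → ℤ), (∀ X, 0 ≤ zT X) ∧ (∀ X, 0 ≤ zS X) ∧ (∀ a, 0 ≤ u a) ∧
      SupportedOn T zT ∧ SupportedOn S zS ∧
      (∀ a, coverage zT (D.tail a) (D.head a) + coverage zS (D.head a) (D.tail a) ≤ c a + u a) ∧
      ∑ X, yT X * demand b X + ∑ X, yS X * demand b X - ∑ a, w a ≤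
        ∑ X, zT X * demand b X + ∑ X, zS X * demand b X - ∑ a, (u a : ℝ) := by
  obtain ⟨yT', pT', hT', lT, cT, vT⟩ :=
    exists_laminarSupport T (demand b) (demand_supermodular hb) yT pT hT
  obtain ⟨yS', pS', hS', lS, cS, vS⟩ :=
    exists_laminarSupport S (demand b) (demand_supermodular hb) yS pS hS
  choose α β hαβ hround using fun a : A =>
    exists_coverage_eq_floorDiff hST hcover hT' hS' lT lS (D.tail a) (D.head a)
  choose α' β' hexc hexcr using fun a : A => exists_excess_eq_floorDiff (α a) (β a) (c a)
  -- The averaged function is the whole dual objective: set weights with coefficient `demand b`, arc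
  -- excesses with coefficient `-1`.
  obtain ⟨θ, hθ⟩ := exists_sum_le_sum_floorDiff (ι := Finset V ⊕ Finset V ⊕ A)
    (Sum.elim (demand b) (Sum.elim (demand b) fun _ => -1))
    (Sum.elim (fun X => weightAbove yT' X - yT' X)
      (Sum.elim (fun X => -weightAbove yS' X) α'))
    (Sum.elim (fun X => weightAbove yT' X)
      (Sum.elim (fun X => yS' X - weightAbove yS' X) β'))
  have m1 : Monotone fun x : ℝ => ⌊x + θ⌋ := fun x y h => Int.floor_le_floor (by linarith)
  have m2 : Monotone fun x : ℝ => -⌊θ - x⌋ := fun x y h =>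
    neg_le_neg (Int.floor_le_floor (by linarith))
  refine ⟨roundAlong (fun x => ⌊x + θ⌋) yT', roundAlong (fun x => -⌊θ - x⌋) yS',
    fun a => max 0 (floorDiff (α a) (β a) θ - c a), roundAlong_nonneg m1 pT',
    roundAlong_nonneg m2 pS', fun a => le_max_left _ _, hT'.roundAlong _, hS'.roundAlong _,
    fun a => ?_, ?_⟩
  · rw [hround]
    linarith [le_max_right 0 (floorDiff (α a) (β a) θ - c a)]
  · have eS : ∀ X, roundAlong (fun x => -⌊θ - x⌋) yS' X =
        floorDiff (-weightAbove yS' X) (yS' X - weightAbove yS' X) θ := fun X => by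
      simp only [roundAlong, floorDiff]
      rw [show θ - (weightAbove yS' X - yS' X) = yS' X - weightAbove yS' X + θ by ring,
        neg_add_eq_sub]
      ring
    have eT : ∀ X, roundAlong (fun x => ⌊x + θ⌋) yT' X =
        floorDiff (weightAbove yT' X - yT' X) (weightAbove yT' X) θ := fun X => rfl
    -- Uncrossing did not increase coverages, so the excess over `c`, the least feasible arc weight,
    -- is at most `w`.
    have hw : ∑ a, (β' a - α' a) ≤ ∑ a, w a := Finset.sum_le_sum fun a _ => by
      rw [← hexc a, ← hαβ a]
      exact max_le (pw a) (by linarith [hc a, cT (D.tail a) (D.head a), cS (D.head a) (D.tail a)])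
    simp only [Fintype.sum_sum_type, Sum.elim_inl, Sum.elim_inr, sub_sub_cancel, sub_neg_eq_add,
      sub_add_cancel, neg_one_mul, Finset.sum_neg_distrib] at hθ
    simp only [eS, eT, hexcr, mul_comm _ (demand b _)] at vT vS ⊢
    linarith

end IntegralWeights

/-! ### Dual solutions as weighted cuts, and total dual integrality -/

section Dual

variable {V A : Type*} [DecidableEq V] [DecidableEq A] [Fintype V] [Fintype A]
  (D : ArcDigraph V A) {S T : Finset V} {b : V → ℕ}

lemma coverage_single {R : Type*} [NonAssocSemiring R] (X : Finset V) (t h : V) :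
    coverage (Pi.single X (1 : R)) t h = if h ∈ X ∧ t ∉ X then 1 else 0 := by
  rw [coverage, Finset.sum_eq_single X (fun Y _ hY => by simp [hY]) (by simp)]
  simp

lemma coverage_zero {R : Type*} [NonAssocSemiring R] (t h : V) :
    coverage (0 : Finset V → R) t h = 0 := by
  simp [coverage]

lemma coverage_sum_mul {ι : Type*} [Fintype ι] (y : ι → ℝ) (F : ι → Finset V → ℝ) (t h : V) :
    coverage (fun X => ∑ i, y i * F i X) t h = ∑ i, y i * coverage (F i) t h := by
  simp only [coverage, Finset.sum_mul, Finset.mul_sum, mul_assoc]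
  exact Finset.sum_comm

omit [Fintype V] in
lemma charVec_deltaIn (X : Finset V) (a : A) :
    charVec (D.deltaIn Finset.univ X) a = if D.head a ∈ X ∧ D.tail a ∉ X then 1 else 0 := by
  simp [charVec, ArcDigraph.deltaIn, and_comm]

omit [Fintype V] in
lemma charVec_deltaOut (X : Finset V) (a : A) :
    charVec (D.deltaOut Finset.univ X) a = if D.tail a ∈ X ∧ D.head a ∉ X then 1 else 0 := by
  simp [charVec, ArcDigraph.deltaOut]

omit [DecidableEq A] in
lemma deltaIn_eq_deltaOut_compl (X : Finset V) :
    D.deltaIn Finset.univ X = D.deltaOut Finset.univ Xᶜ := by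
  simp [ArcDigraph.deltaIn, ArcDigraph.deltaOut]

omit [DecidableEq A] in
/-- A bicut enters a nonempty subset of `T` or leaves a nonempty subset of `S`. -/
lemma ArcDigraph.isBicut_iff (hST : Disjoint S T) (hcover : S ∪ T = Finset.univ) (C : Finset A) :
    D.IsBicut T C ↔ (∃ X : Finset V, (X.Nonempty ∧ X ⊆ T) ∧ C = D.deltaIn Finset.univ X) ∨
      ∃ X : Finset V, (X.Nonempty ∧ X ⊆ S) ∧ C = D.deltaOut Finset.univ X := by
  have hS : Tᶜ = S := by
    ext v
    have h1 : v ∈ S ∪ T := hcover ▸ Finset.mem_univ v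
    have h2 := fun h : v ∈ S => Finset.disjoint_left.1 hST h
    simp only [Finset.mem_union, Finset.mem_compl] at h1 ⊢
    tauto
  constructor
  · rintro ⟨U, hU | ⟨h1, h2⟩, rfl⟩
    · exact Or.inl ⟨U, hU, rfl⟩
    · refine Or.inr ⟨Uᶜ, ⟨?_, ?_⟩, deltaIn_eq_deltaOut_compl D U⟩
      · rwa [Finset.nonempty_iff_ne_empty, Ne, Finset.compl_eq_empty_iff]
      · rw [← hS]; exact Finset.compl_subset_compl.2 h1
  · rintro (⟨X, hX, rfl⟩ | ⟨X, ⟨h1, h2⟩, rfl⟩)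
    · exact ⟨X, Or.inl hX, rfl⟩
    · refine ⟨Xᶜ, Or.inr ⟨?_, ?_⟩, by rw [deltaIn_eq_deltaOut_compl, compl_compl]⟩
      · rw [← Finset.compl_subset_compl, compl_compl, hS]; exact h2
      · rw [Ne, Finset.compl_eq_univ_iff]; exact h1.ne_empty

omit [Fintype V] in
lemma supportedOn_single {P X : Finset V} (hX : X.Nonempty ∧ X ⊆ P) :
    SupportedOn P (Pi.single X (1 : ℝ)) := by
  intro Y hY
  by_cases h : Y = X
  · exact h ▸ hX
  · simp [h] at hY

lemma single_one_nonneg {ι : Type*} [DecidableEq ι] (i j : ι) :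
    (0 : ℝ) ≤ (Pi.single i (1 : ℝ) : ι → ℝ) j := by
  rw [Pi.single_apply]; split_ifs <;> norm_num

omit [DecidableEq V] [Fintype V] in
lemma supportedOn_zero (P : Finset V) : SupportedOn P (0 : Finset V → ℝ) :=
  fun _ h => absurd rfl h

/-- Each row of the system is a combination of a cut inequality and an upper bound. -/
lemma exists_weights_of_row (hST : Disjoint S T) (hcover : S ∪ T = Finset.univ)
    (hb : ∀ v, 0 < b v) (i : D.Row S T) :
    ∃ (yT yS : Finset V → ℝ) (w : A → ℝ), (∀ X, 0 ≤ yT X) ∧ (∀ X, 0 ≤ yS X) ∧ (∀ a, 0 ≤ w a) ∧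
      SupportedOn T yT ∧ SupportedOn S yS ∧
      (∀ a, coverage yT (D.tail a) (D.head a) + coverage yS (D.head a) (D.tail a) - w a ≤
        D.rowMatrix S T i a) ∧
      D.rowRhs S T b i ≤
        ∑ X, yT X * demand b X + ∑ X, yS X * demand b X - ∑ a, w a := by
  suffices h : (∃ X : Finset V, (X.Nonempty ∧ X ⊆ T) ∧
      D.rowMatrix S T i = charVec (D.deltaIn Finset.univ X) ∧ D.rowRhs S T b i ≤ demand b X) ∨
      (∃ X : Finset V, (X.Nonempty ∧ X ⊆ S) ∧
        D.rowMatrix S T i = charVec (D.deltaOut Finset.univ X) ∧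
        D.rowRhs S T b i ≤ demand b X) ∨ (∃ a, i = .nonneg a) ∨ ∃ a, i = .leOne a by
    rcases h with ⟨X, hX, hM, hr⟩ | ⟨X, hX, hM, hr⟩ | ⟨a, rfl⟩ | ⟨a, rfl⟩
    · exact ⟨Pi.single X 1, 0, 0, single_one_nonneg X, fun _ => le_rfl, fun _ => le_rfl,
        supportedOn_single hX, supportedOn_zero S, fun a => by
          simp [coverage_single, coverage_zero, hM, charVec_deltaIn], by
          simpa [Pi.single_apply] using hr⟩
    · exact ⟨0, Pi.single X 1, 0, fun _ => le_rfl, single_one_nonneg X, fun _ => le_rfl,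
        supportedOn_zero T, supportedOn_single hX, fun a => by
          simp [coverage_single, coverage_zero, hM, charVec_deltaOut], by
          simpa [Pi.single_apply] using hr⟩
    · refine ⟨0, 0, 0, fun _ => le_rfl, fun _ => le_rfl, fun _ => le_rfl,
        supportedOn_zero T, supportedOn_zero S, fun a' => ?_, by simp [ArcDigraph.rowRhs]⟩
      simp only [coverage_zero, ArcDigraph.rowMatrix, charVec]
      split_ifs <;> simp
    · refine ⟨0, 0, Pi.single a 1, fun _ => le_rfl, fun _ => le_rfl, single_one_nonneg a,
        supportedOn_zero T, supportedOn_zero S, fun a' => ?_, by simp [ArcDigraph.rowRhs]⟩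
      simp [coverage_zero, ArcDigraph.rowMatrix, charVec, Pi.single_apply]
  cases i with
  | inDegree v =>
    exact Or.inl ⟨{v.1}, by simp, rfl, by simp [ArcDigraph.rowRhs, demand_singleton]⟩
  | outDegree v =>
    exact Or.inr (Or.inl ⟨{v.1}, by simp, rfl, by simp [ArcDigraph.rowRhs, demand_singleton]⟩)
  | bicut C =>
    rcases (D.isBicut_iff hST hcover C.1).1 C.2 with ⟨X, hX, hC⟩ | ⟨X, hX, hC⟩
    · exact Or.inl ⟨X, hX, congrArg charVec hC, one_le_demand hb X⟩
    · exact Or.inr (Or.inl ⟨X, hX, congrArg charVec hC, one_le_demand hb X⟩)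
  | nonneg a => exact Or.inr (Or.inr (Or.inl ⟨a, rfl⟩))
  | leOne a => exact Or.inr (Or.inr (Or.inr ⟨a, rfl⟩))

lemma exists_weights_of_dual (hST : Disjoint S T) (hcover : S ∪ T = Finset.univ)
    (hb : ∀ v, 0 < b v) {y : D.Row S T → ℝ} (hy : ∀ i, 0 ≤ y i) :
    ∃ (yT yS : Finset V → ℝ) (w : A → ℝ), (∀ X, 0 ≤ yT X) ∧ (∀ X, 0 ≤ yS X) ∧ (∀ a, 0 ≤ w a) ∧
      SupportedOn T yT ∧ SupportedOn S yS ∧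
      (∀ a, coverage yT (D.tail a) (D.head a) + coverage yS (D.head a) (D.tail a) - w a ≤
        (y ᵥ* D.rowMatrix S T) a) ∧
      y ⬝ᵥ D.rowRhs S T b ≤
        ∑ X, yT X * demand b X + ∑ X, yS X * demand b X - ∑ a, w a := by
  choose FT FS Fw pT pS pw sT sS hM hr using
    fun i : D.Row S T => exists_weights_of_row D hST hcover hb i
  have supp : ∀ {P : Finset V} {F : D.Row S T → Finset V → ℝ}, (∀ i, SupportedOn P (F i)) →
      SupportedOn P fun X => ∑ i, y i * F i X := fun h X hX => by
    obtain ⟨i, -, hi⟩ := Finset.exists_ne_zero_of_sum_ne_zero hX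
    exact h i X (right_ne_zero_of_mul hi)
  refine ⟨fun X => ∑ i, y i * FT i X, fun X => ∑ i, y i * FS i X, fun a => ∑ i, y i * Fw i a,
    fun X => Finset.sum_nonneg fun i _ => mul_nonneg (hy i) (pT i X),
    fun X => Finset.sum_nonneg fun i _ => mul_nonneg (hy i) (pS i X),
    fun a => Finset.sum_nonneg fun i _ => mul_nonneg (hy i) (pw i a), supp sT, supp sS,
    fun a => ?_, ?_⟩
  · rw [coverage_sum_mul, coverage_sum_mul, ← Finset.sum_add_distrib, ← Finset.sum_sub_distrib]
    refine Finset.sum_le_sum fun i _ => ?_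
    rw [← mul_add, ← mul_sub]
    exact mul_le_mul_of_nonneg_left (hM i a) (hy i)
  · have e : ∀ F : D.Row S T → Finset V → ℝ, ∑ X, (∑ i, y i * F i X) * demand b X =
        ∑ i, y i * ∑ X, F i X * demand b X := fun F => by
      simp only [Finset.sum_mul, Finset.mul_sum, mul_assoc]
      exact Finset.sum_comm
    have e' : ∑ a, ∑ i, y i * Fw i a = ∑ i, y i * ∑ a, Fw i a := by
      simp only [Finset.mul_sum]
      exact Finset.sum_comm
    rw [e, e, e', ← Finset.sum_add_distrib, ← Finset.sum_sub_distrib]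
    refine Finset.sum_le_sum fun i _ => ?_
    rw [← mul_add, ← mul_sub]
    exact mul_le_mul_of_nonneg_left (hr i) (hy i)

/-- The row with the inequality for the arcs entering `X ⊆ T`. -/
lemma exists_row_of_subset_target {X : Finset V} (hX : X.Nonempty ∧ X ⊆ T) :
    ∃ i : D.Row S T, D.rowMatrix S T i = charVec (D.deltaIn Finset.univ X) ∧
      D.rowRhs S T b i = demand b X := by
  -- A singleton must use its degree row, since its bicut row only provides right-hand side `1`.
  by_cases h : X.card = 1
  · obtain ⟨v, rfl⟩ := Finset.card_eq_one.1 h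
    exact ⟨.inDegree ⟨v, hX.2 (by simp)⟩, rfl, (demand_singleton v).symm⟩
  · exact ⟨.bicut ⟨_, X, Or.inl hX, rfl⟩, rfl, (demand_of_card_ne_one h).symm⟩

/-- The row with the inequality for the arcs leaving `X ⊆ S`. -/
lemma exists_row_of_subset_source (hST : Disjoint S T) (hcover : S ∪ T = Finset.univ)
    {X : Finset V} (hX : X.Nonempty ∧ X ⊆ S) :
    ∃ i : D.Row S T, D.rowMatrix S T i = charVec (D.deltaOut Finset.univ X) ∧
      D.rowRhs S T b i = demand b X := by
  by_cases h : X.card = 1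
  · obtain ⟨v, rfl⟩ := Finset.card_eq_one.1 h
    exact ⟨.outDegree ⟨v, hX.2 (by simp)⟩, rfl, (demand_singleton v).symm⟩
  · exact ⟨.bicut ⟨_, (D.isBicut_iff hST hcover _).2 (Or.inr ⟨X, hX, rfl⟩)⟩, rfl,
      (demand_of_card_ne_one h).symm⟩

/-- The pairs of left-hand side and right-hand side of the nonnegative integral combinations of the
inequalities of `M x ≥ r`. -/
def integralCombinations {ι α : Type*} [Fintype ι] (M : Matrix ι α ℝ) (r : ι → ℝ) :
    AddSubmonoid ((α → ℝ) × ℝ) where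
  carrier := {p | ∃ z : ι → ℤ, (∀ i, 0 ≤ z i) ∧ (fun i => (z i : ℝ)) ᵥ* M = p.1 ∧
    (fun i => (z i : ℝ)) ⬝ᵥ r = p.2}
  zero_mem' := ⟨0, fun _ => le_rfl, by ext; simp [Matrix.vecMul, dotProduct],
    by simp [dotProduct]⟩
  add_mem' := by
    rintro p q ⟨z, hz, hz1, hz2⟩ ⟨z', hz', hz1', hz2'⟩
    have e : (fun i => (((z + z') i : ℤ) : ℝ)) = (fun i => (z i : ℝ)) + fun i => (z' i : ℝ) := by
      ext; simp
    exact ⟨z + z', fun i => add_nonneg (hz i) (hz' i), by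
      rw [e, Matrix.add_vecMul, hz1, hz1']; rfl, by rw [e, add_dotProduct, hz2, hz2']; rfl⟩

lemma row_mem_integralCombinations {ι α : Type*} [Fintype ι] (M : Matrix ι α ℝ) (r : ι → ℝ)
    (i : ι) {n : ℤ} (hn : 0 ≤ n) : ((n : ℝ) • M i, (n : ℝ) * r i) ∈ integralCombinations M r := by
  classical
  have e : (fun j => ((Pi.single i n : ι → ℤ) j : ℝ)) = Pi.single i (n : ℝ) := by
    ext j
    by_cases h : j = i
    · subst h; simp
    · simp [h]
  refine ⟨Pi.single i n, fun j => ?_, by rw [e, Matrix.single_vecMul]; rfl, by rw [e, single_dotProduct]⟩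
  rw [Pi.single_apply]; split_ifs <;> simp [hn]

/-- Integral weights come from an integral dual solution. -/
lemma exists_dual_of_weights (hST : Disjoint S T) (hcover : S ∪ T = Finset.univ)
    (c : A → ℤ) {zT zS : Finset V → ℤ} {u : A → ℤ} (pT : ∀ X, 0 ≤ zT X) (pS : ∀ X, 0 ≤ zS X)
    (pu : ∀ a, 0 ≤ u a) (sT : SupportedOn T zT) (sS : SupportedOn S zS)
    (hc : ∀ a,
      coverage zT (D.tail a) (D.head a) + coverage zS (D.head a) (D.tail a) ≤ c a + u a) :
    ∃ z : D.Row S T → ℤ,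
      (fun i => (z i : ℝ)) ∈ dualFeasible (D.rowMatrix S T) (fun a => (c a : ℝ)) ∧
      (fun i => (z i : ℝ)) ⬝ᵥ D.rowRhs S T b =
        ∑ X, zT X * demand b X + ∑ X, zS X * demand b X - ∑ a, (u a : ℝ) := by
  -- Distinct sets may define the same bicut and hence share a row. Summing inside a submonoid
  -- collects the multiplicities.
  let L := integralCombinations (D.rowMatrix S T) (D.rowRhs S T b)
  have hL1 : ∑ X, ((zT X : ℝ) • charVec (D.deltaIn Finset.univ X), zT X * demand b X) ∈ L := by
    refine sum_mem fun X _ => ?_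
    by_cases h : zT X = 0
    · simp only [h, Int.cast_zero, zero_smul, zero_mul]
      exact L.zero_mem
    · obtain ⟨i, h1, h2⟩ := exists_row_of_subset_target D (b := b) (S := S) (sT X h)
      rw [← h1, ← h2]
      exact row_mem_integralCombinations _ _ i (pT X)
  have hL2 : ∑ X, ((zS X : ℝ) • charVec (D.deltaOut Finset.univ X), zS X * demand b X) ∈ L := by
    refine sum_mem fun X _ => ?_
    by_cases h : zS X = 0
    · simp only [h, Int.cast_zero, zero_smul, zero_mul]
      exact L.zero_mem
    · obtain ⟨i, h1, h2⟩ := exists_row_of_subset_source D (b := b) hST hcover (sS X h)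
      rw [← h1, ← h2]
      exact row_mem_integralCombinations _ _ i (pS X)
  have hL3 := sum_mem (S := L) (t := Finset.univ) fun a _ =>
    row_mem_integralCombinations (D.rowMatrix S T) (D.rowRhs S T b) (.leOne a) (pu a)
  -- The slack in `hc` is put on the nonnegativity rows, which have right-hand side `0`; this turns
  -- the inequality into equality with `c` at no cost.
  have hL4 := sum_mem (S := L) (t := Finset.univ) fun a _ =>
    row_mem_integralCombinations (D.rowMatrix S T) (D.rowRhs S T b) (.nonneg a)
      (sub_nonneg.2 (hc a))
  obtain ⟨z, hz, hz1, hz2⟩ := add_mem (add_mem hL1 hL2) (add_mem hL3 hL4)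
  refine ⟨z, ⟨fun i => Int.cast_nonneg (hz i), ?_⟩, ?_⟩
  · rw [hz1]
    ext a
    simp only [Prod.fst_add, Prod.fst_sum, Pi.add_apply, Finset.sum_apply, Pi.smul_apply,
      charVec_deltaIn, charVec_deltaOut, smul_eq_mul, ArcDigraph.rowMatrix, Pi.neg_apply]
    simp only [charVec, Finset.mem_singleton, coverage]
    simp
    ring
  · rw [hz2]
    simp [Prod.snd_sum, ArcDigraph.rowRhs, sub_eq_add_neg]

omit [DecidableEq A] in
lemma exists_rowRhs_eq_intCast (i : D.Row S T) : ∃ n : ℤ, D.rowRhs S T b i = n := by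
  rcases i with v | v | C | a | a
  · exact ⟨b v.1, by simp [ArcDigraph.rowRhs]⟩
  · exact ⟨b v.1, by simp [ArcDigraph.rowRhs]⟩
  · exact ⟨1, by simp [ArcDigraph.rowRhs]⟩
  · exact ⟨0, by simp [ArcDigraph.rowRhs]⟩
  · exact ⟨-1, by simp [ArcDigraph.rowRhs]⟩

theorem isTDI_rowMatrix (hST : Disjoint S T) (hcover : S ∪ T = Finset.univ)
    (hb : ∀ v, 0 < b v) : IsTDI (D.rowMatrix S T) (D.rowRhs S T b) := by
  intro c hne hbdd
  have hint : ∀ y ∈ dualFeasible (D.rowMatrix S T) (fun a => (c a : ℝ)), ∃ z : D.Row S T → ℤ,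
      (fun i => (z i : ℝ)) ∈ dualFeasible (D.rowMatrix S T) (fun a => (c a : ℝ)) ∧
      y ⬝ᵥ D.rowRhs S T b ≤ (fun i => (z i : ℝ)) ⬝ᵥ D.rowRhs S T b := by
    rintro y ⟨hy, hyM⟩
    obtain ⟨yT, yS, w, pT, pS, pw, sT, sS, hM, hr⟩ := exists_weights_of_dual D hST hcover hb hy
    obtain ⟨zT, zS, u, qT, qS, qu, sT', sS', hc', hv⟩ :=
      exists_integral_weights D hST hcover hb c pT pS pw sT sS fun a => by
        have := hM a
        rw [hyM] at this
        linarith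
    obtain ⟨z, hz, hzr⟩ := exists_dual_of_weights D (b := b) hST hcover c qT qS qu sT' sS' hc'
    exact ⟨z, hz, by rw [hzr]; exact hr.trans hv⟩
  have hval : ∀ z : D.Row S T → ℤ, ∃ n : ℤ, (fun i => (z i : ℝ)) ⬝ᵥ D.rowRhs S T b = n := by
    intro z
    choose n hn using exists_rowRhs_eq_intCast D (S := S) (T := T) (b := b)
    exact ⟨∑ i, z i * n i, by simp [dotProduct, hn]⟩
  obtain ⟨B, hB⟩ := hbdd
  obtain ⟨y₀, hy₀⟩ := hne
  obtain ⟨z₀, hz₀, -⟩ := hint y₀ hy₀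
  obtain ⟨n₀, hn₀⟩ := hval z₀
  -- The attained integral values form a nonempty set of integers bounded above, so attainment needs
  -- no compactness of the dual region.
  obtain ⟨m, ⟨z, hz, hzm⟩, hmax⟩ := Int.exists_greatest_of_bdd
    (P := fun n : ℤ => ∃ z : D.Row S T → ℤ,
      (fun i => (z i : ℝ)) ∈ dualFeasible (D.rowMatrix S T) (fun a => (c a : ℝ)) ∧
      (fun i => (z i : ℝ)) ⬝ᵥ D.rowRhs S T b = n)
    ⟨⌊B⌋, fun n ⟨z, hz, hzn⟩ => Int.le_floor.2 (hzn ▸ hB ⟨_, hz, rfl⟩)⟩ ⟨n₀, z₀, hz₀, hn₀⟩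
  refine ⟨z, hz, fun y hy => ?_⟩
  obtain ⟨z', hz', hle⟩ := hint y hy
  obtain ⟨n, hn⟩ := hval z'
  refine hle.trans ?_
  rw [hn, hzm]
  exact_mod_cast hmax n ⟨z', hz', hn⟩

end Dual

/-! ### Integral extreme points from total dual integrality -/

section Integrality

variable {ι α : Type*} [Fintype ι] [Fintype α] {M : Matrix ι α ℝ} {r : ι → ℝ}

omit [Fintype ι] in
lemma convex_solutionSet (M : Matrix ι α ℝ) (r : ι → ℝ) : Convex ℝ (solutionSet M r) := by
  intro x hx y hy s t hs ht hst i
  have h : (M *ᵥ (s • x + t • y)) i = s * (M *ᵥ x) i + t * (M *ᵥ y) i := by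
    simp [Matrix.mulVec_add, Matrix.mulVec_smul]
  rw [h]
  calc r i = s * r i + t * r i := by rw [← add_mul, hst, one_mul]
    _ ≤ _ := add_le_add (mul_le_mul_of_nonneg_left (hx i) hs) (mul_le_mul_of_nonneg_left (hy i) ht)

omit [Fintype ι] in
lemma isClosed_solutionSet (M : Matrix ι α ℝ) (r : ι → ℝ) : IsClosed (solutionSet M r) := by
  simp only [solutionSet, Set.ofPred_forall]
  exact isClosed_iInter fun i => isClosed_le continuous_const
    (continuous_finsetSum _ fun a _ => continuous_const.mul (continuous_apply a))

/-- The tight inequalities at an extreme point determine it. -/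
lemma eq_zero_of_tight_mulVec_eq_zero {x : α → ℝ} (hx : x ∈ (solutionSet M r).extremePoints ℝ)
    {d : α → ℝ} (hd : ∀ i, (M *ᵥ x) i = r i → (M *ᵥ d) i = 0) : d = 0 := by
  -- Along `d'` tight rows stay tight and slack rows stay slack for small `ε`; applied to `d` and
  -- `-d`, this makes `x` a midpoint of feasible points.
  have hev : ∀ d' : α → ℝ, (∀ i, (M *ᵥ x) i = r i → (M *ᵥ d') i = 0) →
      ∀ᶠ ε : ℝ in nhdsWithin 0 (Set.Ioi 0), x + ε • d' ∈ solutionSet M r := by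
    intro d' hd'
    refine Filter.Eventually.filter_mono nhdsWithin_le_nhds (Filter.eventually_all.2 fun i => ?_)
    have e : ∀ ε : ℝ, (M *ᵥ (x + ε • d')) i = (M *ᵥ x) i + ε * (M *ᵥ d') i := fun ε => by
      simp [Matrix.mulVec_add, Matrix.mulVec_smul]
    simp only [e]
    rcases (hx.1 i).eq_or_lt with h | h
    · simp [hd' i h.symm, h]
    · have hc : Continuous fun ε : ℝ => (M *ᵥ x) i + ε * (M *ᵥ d') i := by fun_prop
      have ht := hc.tendsto 0
      simp only [zero_mul, add_zero] at ht
      exact (ht.eventually_const_lt h).mono fun ε hε => hε.le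
  obtain ⟨ε, ⟨h1, h2⟩, hε⟩ := (((hev d hd).and (hev (-d) fun i hi => by
    rw [Matrix.mulVec_neg, Pi.neg_apply, hd i hi, neg_zero])).and self_mem_nhdsWithin).exists
  have hmem : x ∈ openSegment ℝ (x + ε • d) (x + ε • (-d)) :=
    ⟨1 / 2, 1 / 2, by norm_num, by norm_num, by norm_num, by
      ext a; simp only [Pi.add_apply, Pi.smul_apply, Pi.neg_apply, smul_eq_mul]; ring⟩
  have h := hx.2 h1 h2 hmem
  have hz : ε • d = 0 := by simpa using h
  exact (smul_eq_zero.1 hz).resolve_left (ne_of_gt hε)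

/-- A nonzero functional vanishing on the tight rows would be a nonzero direction in the kernel of
all of them, impossible at an extreme point. -/
lemma span_tight_rows_eq_top {x : α → ℝ} (hx : x ∈ (solutionSet M r).extremePoints ℝ) :
    Submodule.span ℝ (Set.range fun i : {i // (M *ᵥ x) i = r i} => M i.1) = ⊤ := by
  classical
  by_contra hne
  obtain ⟨f, hf0, hf⟩ := Submodule.exists_le_ker_of_lt_top _ (lt_top_iff_ne_top.2 hne)
  have hfd : ∀ v : α → ℝ, f v = v ⬝ᵥ fun a => f (Pi.single a 1) := fun v => by
    conv_lhs => rw [pi_eq_sum_univ' v]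
    simp [map_sum, dotProduct]
  have hd := eq_zero_of_tight_mulVec_eq_zero hx (d := fun a => f (Pi.single a 1)) fun i hi => by
    rw [Matrix.mulVec, ← hfd]
    exact hf (Submodule.subset_span ⟨⟨i, hi⟩, rfl⟩)
  exact hf0 (LinearMap.ext fun v => by rw [hfd, hd]; simp)

/-- By weak duality and total dual integrality, integral costs have an integral value at a point
that satisfies complementary slackness with a dual solution. -/
lemma IsTDI.exists_dotProduct_eq_intCast (h : IsTDI M r) (hr : ∀ i, ∃ n : ℤ, r i = n)
    {x : α → ℝ} (hx : x ∈ solutionSet M r) {y : ι → ℝ} (hy : ∀ i, 0 ≤ y i)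
    (hyx : ∀ i, y i ≠ 0 → (M *ᵥ x) i = r i) {c : α → ℤ} (hc : y ᵥ* M = fun a => (c a : ℝ)) :
    ∃ n : ℤ, (fun a => (c a : ℝ)) ⬝ᵥ x = n := by
  have hweak : ∀ y' ∈ dualFeasible M (fun a => (c a : ℝ)), y' ⬝ᵥ r ≤ (fun a => (c a : ℝ)) ⬝ᵥ x := by
    rintro y' ⟨h1, h2⟩
    rw [← h2, ← Matrix.dotProduct_mulVec]
    exact Finset.sum_le_sum fun i _ => mul_le_mul_of_nonneg_left (hx i) (h1 i)
  have hyr : y ⬝ᵥ r = (fun a => (c a : ℝ)) ⬝ᵥ x := by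
    rw [← hc, ← Matrix.dotProduct_mulVec]
    refine Finset.sum_congr rfl fun i _ => ?_
    by_cases hi : y i = 0
    · simp [hi]
    · rw [hyx i hi]
  have hyf : y ∈ dualFeasible M (fun a => (c a : ℝ)) := ⟨hy, hc⟩
  obtain ⟨z, hz, hmax⟩ := h c ⟨y, hyf⟩ ⟨_, by rintro _ ⟨y', hy', rfl⟩; exact hweak y' hy'⟩
  choose n hn using hr
  refine ⟨∑ i, z i * n i, ?_⟩
  rw [← (hweak _ hz).antisymm (hyr ▸ hmax y hyf)]
  simp [dotProduct, hn]

/-- The extreme points of the solution set of a totally dual integral system with integral data are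
integral. -/
theorem IsTDI.extremePoints_integral (h : IsTDI M r) (hM : ∀ i a, ∃ n : ℤ, M i a = n)
    (hr : ∀ i, ∃ n : ℤ, r i = n) {x : α → ℝ} (hx : x ∈ (solutionSet M r).extremePoints ℝ)
    (a : α) : ∃ n : ℤ, x a = n := by
  classical
  have hspan : Pi.single a (1 : ℝ) ∈
      Submodule.span ℝ (Set.range fun i : {i // (M *ᵥ x) i = r i} => M i.1) := by
    rw [span_tight_rows_eq_top hx]; trivial
  obtain ⟨l, hl⟩ := Submodule.mem_span_range_iff_exists_fun ℝ |>.1 hspan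
  -- Adding `K` to all coefficients makes them nonnegative. Then `c₀` and `c₀` plus the `a`-th unit
  -- vector are integral costs in the cone of the tight rows, so both have integral value at `x`;
  -- their difference is `x a`. Taking `K` integral keeps `c₀` integral.
  obtain ⟨K, hK⟩ : ∃ K : ℕ, ∀ i, |l i| ≤ K := by
    obtain ⟨K, hK⟩ := exists_nat_ge (∑ i, |l i|)
    exact ⟨K, fun i => le_trans
      (Finset.single_le_sum (fun j _ => abs_nonneg (l j)) (Finset.mem_univ i)) hK⟩
  choose m hm using hM
  let c₀ : α → ℤ := fun a' => ∑ i : {i // (M *ᵥ x) i = r i}, K * m i.1 a'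
  have hext : ∀ g : {i // (M *ᵥ x) i = r i} → ℝ,
      (fun i => if hi : (M *ᵥ x) i = r i then g ⟨i, hi⟩ else 0) ᵥ* M = ∑ i, g i • M i.1 := by
    intro g
    ext a'
    simp only [Matrix.vecMul, dotProduct, Finset.sum_apply, Pi.smul_apply, smul_eq_mul]
    rw [← Fintype.sum_subtype_add_sum_subtype (fun i => (M *ᵥ x) i = r i),
      Finset.sum_eq_zero (s := (Finset.univ : Finset {i // ¬ (M *ᵥ x) i = r i}))
        fun i _ => by rw [dif_neg i.2, zero_mul], add_zero]
    exact Finset.sum_congr rfl fun i _ => by rw [dif_pos i.2]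
  have key : ∀ (g : {i // (M *ᵥ x) i = r i} → ℝ) (c : α → ℤ), (∀ i, 0 ≤ g i) →
      ∑ i, g i • M i.1 = (fun a => (c a : ℝ)) → ∃ n : ℤ, (fun a => (c a : ℝ)) ⬝ᵥ x = n := by
    intro g c hg hc
    refine h.exists_dotProduct_eq_intCast hr hx.1
      (y := fun i => if hi : (M *ᵥ x) i = r i then g ⟨i, hi⟩ else 0) (fun i => ?_) (fun i hi => ?_)
      ((hext g).trans hc)
    · split_ifs
      exacts [hg _, le_rfl]
    · by_contra hne; simp [hne] at hi
  obtain ⟨n₀, hn₀⟩ := key (fun _ => K) c₀ (fun _ => Nat.cast_nonneg K) (by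
    ext a'; simp [c₀, hm])
  obtain ⟨n₁, hn₁⟩ := key (fun i => K + l i) (c₀ + Pi.single a 1)
    (fun i => by linarith [neg_le_of_abs_le (hK i)]) (by
      simp only [add_smul, Finset.sum_add_distrib, hl]
      ext a'
      by_cases e : a' = a
      · subst e; simp [c₀, hm]
      · simp [c₀, hm, e])
  refine ⟨n₁ - n₀, ?_⟩
  have e : (fun a' => (((c₀ + Pi.single a 1 : α → ℤ) a' : ℤ) : ℝ)) =
      (fun a' => (c₀ a' : ℝ)) + Pi.single a 1 := by
    ext a'
    by_cases e : a' = a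
    · subst e; simp
    · simp [e]
  rw [e, add_dotProduct, hn₀, single_dotProduct, one_mul] at hn₁
  push_cast
  linarith

end Integrality

/-! ### The 0-1 solutions and the polytope -/

section Polytope

variable {V A : Type*} [DecidableEq V] [DecidableEq A] [Fintype A]
  (D : ArcDigraph V A) {S T : Finset V} {b : V → ℕ}

lemma charVec_dotProduct (C : Finset A) (x : A → ℝ) : charVec C ⬝ᵥ x = ∑ a ∈ C, x a := by
  simp [charVec, dotProduct]

lemma charVec_dotProduct_charVec (C B : Finset A) :
    charVec C ⬝ᵥ charVec B = ((C ∩ B).card : ℝ) := by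
  rw [charVec_dotProduct]; simp [charVec]

omit [DecidableEq A] [Fintype A] in
lemma ArcDigraph.Reaches.exists_entering {B : Finset A} {u v : V} (h : D.Reaches B u v)
    {X : Finset V} (hu : u ∉ X) (hv : v ∈ X) : ∃ a ∈ B, D.tail a ∉ X ∧ D.head a ∈ X := by
  induction h with
  | refl => exact absurd hv hu
  | @tail v' v _ hstep ih =>
    by_cases hv' : v' ∈ X
    · exact ih hv'
    · obtain ⟨a, ha, rfl, rfl⟩ := hstep
      exact ⟨a, ha, hv', hv⟩

lemma deltaIn_univ_inter (B : Finset A) (X : Finset V) :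
    D.deltaIn Finset.univ X ∩ B = D.deltaIn B X := by
  ext a; simp [ArcDigraph.deltaIn, and_comm]

lemma deltaOut_univ_inter (B : Finset A) (X : Finset V) :
    D.deltaOut Finset.univ X ∩ B = D.deltaOut B X := by
  ext a; simp [ArcDigraph.deltaOut, and_comm]

variable [Fintype V]

/-- The `0`-`1` solutions of the system are the characteristic vectors of `b`-bibranchings. -/
lemma charVec_mem_solutionSet_iff (hST : Disjoint S T) (hcover : S ∪ T = Finset.univ)
    (B : Finset A) :
    charVec B ∈ solutionSet (D.rowMatrix S T) (D.rowRhs S T b) ↔ D.IsBBibranching S T b B := by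
  have notS : ∀ v ∈ T, v ∉ S := fun v hv hv' => Finset.disjoint_left.1 hST hv' hv
  have mem : ∀ v, v ∈ S ∨ v ∈ T := fun v => by
    rw [← Finset.mem_union, hcover]; exact Finset.mem_univ v
  constructor
  · intro h
    have hin : ∀ X : Finset V, X.Nonempty ∧ X ⊆ T → ∃ a ∈ B, D.tail a ∉ X ∧ D.head a ∈ X := by
      intro X hX
      have h1 : (1 : ℝ) ≤ charVec (D.deltaIn Finset.univ X) ⬝ᵥ charVec B :=
        h (.bicut ⟨_, X, Or.inl hX, rfl⟩)
      rw [charVec_dotProduct_charVec, deltaIn_univ_inter] at h1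
      obtain ⟨a, ha⟩ := Finset.card_pos.1 (show 0 < (D.deltaIn B X).card by exact_mod_cast h1)
      exact ⟨a, by simpa [ArcDigraph.deltaIn] using ha⟩
    have hout : ∀ X : Finset V, X.Nonempty ∧ X ⊆ S → ∃ a ∈ B, D.tail a ∈ X ∧ D.head a ∉ X := by
      intro X hX
      have h1 : (1 : ℝ) ≤ charVec (D.deltaOut Finset.univ X) ⬝ᵥ charVec B :=
        h (.bicut ⟨_, (D.isBicut_iff hST hcover _).2 (Or.inr ⟨X, hX, rfl⟩)⟩)
      rw [charVec_dotProduct_charVec, deltaOut_univ_inter] at h1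
      obtain ⟨a, ha⟩ := Finset.card_pos.1 (show 0 < (D.deltaOut B X).card by exact_mod_cast h1)
      exact ⟨a, by simpa [ArcDigraph.deltaOut] using ha⟩
    classical
    refine ⟨fun v hv => ?_, fun u hu => ?_, fun v hv => ?_, fun u hu => ?_⟩
    · by_contra hcon
      -- The vertices of `T` unreachable from `S` would form a nonempty set; its cut inequality
      -- gives an arc of `B` entering it, whose tail is in `S` or reachable from `S`, so its head is
      -- reachable too.
      obtain ⟨a, ha, ht, hh⟩ := hin (T.filter fun v => ¬ ∃ u ∈ S, D.Reaches B u v)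
        ⟨⟨v, Finset.mem_filter.2 ⟨hv, hcon⟩⟩, Finset.filter_subset _ _⟩
      refine (Finset.mem_filter.1 hh).2 ?_
      rcases mem (D.tail a) with hS | hT
      · exact ⟨_, hS, Relation.ReflTransGen.single ⟨a, ha, rfl, rfl⟩⟩
      · obtain ⟨u, hu, hur⟩ : ∃ u ∈ S, D.Reaches B u (D.tail a) := by
          by_contra hn; exact ht (Finset.mem_filter.2 ⟨hT, hn⟩)
        exact ⟨u, hu, Relation.ReflTransGen.tail hur ⟨a, ha, rfl, rfl⟩⟩
    · by_contra hcon
      obtain ⟨a, ha, ht, hh⟩ := hout (S.filter fun u => ¬ ∃ v ∈ T, D.Reaches B u v)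
        ⟨⟨u, Finset.mem_filter.2 ⟨hu, hcon⟩⟩, Finset.filter_subset _ _⟩
      refine (Finset.mem_filter.1 ht).2 ?_
      rcases mem (D.head a) with hS | hT
      · obtain ⟨v, hv, hvr⟩ : ∃ v ∈ T, D.Reaches B (D.head a) v := by
          by_contra hn; exact hh (Finset.mem_filter.2 ⟨hS, hn⟩)
        exact ⟨v, hv, Relation.ReflTransGen.head ⟨a, ha, rfl, rfl⟩ hvr⟩
      · exact ⟨_, hT, Relation.ReflTransGen.single ⟨a, ha, rfl, rfl⟩⟩
    · have h1 : (b v : ℝ) ≤ charVec (D.deltaIn Finset.univ {v}) ⬝ᵥ charVec B :=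
        h (.inDegree ⟨v, hv⟩)
      rw [charVec_dotProduct_charVec, deltaIn_univ_inter] at h1
      exact_mod_cast h1
    · have h1 : (b u : ℝ) ≤ charVec (D.deltaOut Finset.univ {u}) ⬝ᵥ charVec B :=
        h (.outDegree ⟨u, hu⟩)
      rw [charVec_dotProduct_charVec, deltaOut_univ_inter] at h1
      exact_mod_cast h1
  · rintro hB (v | u | C | a | a)
    · change (b v.1 : ℝ) ≤ charVec (D.deltaIn Finset.univ {v.1}) ⬝ᵥ charVec B
      rw [charVec_dotProduct_charVec, deltaIn_univ_inter]
      exact_mod_cast hB.le_inDegree v.1 v.2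
    · change (b u.1 : ℝ) ≤ charVec (D.deltaOut Finset.univ {u.1}) ⬝ᵥ charVec B
      rw [charVec_dotProduct_charVec, deltaOut_univ_inter]
      exact_mod_cast hB.le_outDegree u.1 u.2
    · change (1 : ℝ) ≤ charVec C.1 ⬝ᵥ charVec B
      rw [charVec_dotProduct_charVec]
      obtain ⟨C, hC⟩ := C
      suffices h : (C ∩ B).Nonempty by exact_mod_cast Finset.card_pos.2 h
      rcases (D.isBicut_iff hST hcover C).1 hC with ⟨X, ⟨⟨v, hv⟩, hXT⟩, rfl⟩ | ⟨X, ⟨⟨u, hu⟩, hXS⟩, rfl⟩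
      · obtain ⟨u, hu, hr⟩ := hB.reachable v (hXT hv)
        obtain ⟨a, ha, ht, hh⟩ := hr.exists_entering D (fun hX => notS u (hXT hX) hu) hv
        exact ⟨a, by simp [ArcDigraph.deltaIn, ha, ht, hh]⟩
      · obtain ⟨v, hv, hr⟩ := hB.reaching u (hXS hu)
        obtain ⟨a, ha, ht, hh⟩ := hr.exists_entering D (X := Xᶜ) (by simpa using hu)
          (by simpa using fun hX => notS v hv (hXS hX))
        exact ⟨a, by simp only [Finset.mem_compl, not_not] at ht hh; simp [ArcDigraph.deltaOut, ha, ht, hh]⟩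
    · change (0 : ℝ) ≤ charVec {a} ⬝ᵥ charVec B
      rw [charVec_dotProduct_charVec]
      positivity
    · change (-1 : ℝ) ≤ (-charVec {a}) ⬝ᵥ charVec B
      rw [neg_dotProduct, charVec_dotProduct_charVec]
      have : ({a} ∩ B).card ≤ 1 := (Finset.card_le_card Finset.inter_subset_left).trans (by simp)
      have : ((({a} : Finset A) ∩ B).card : ℝ) ≤ 1 := by exact_mod_cast this
      linarith

lemma solutionSet_subset_Icc :
    solutionSet (D.rowMatrix S T) (D.rowRhs S T b) ⊆ Set.Icc 0 1 := by
  intro x hx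
  refine ⟨fun a => ?_, fun a => ?_⟩
  · have h : (0 : ℝ) ≤ charVec {a} ⬝ᵥ x := hx (.nonneg a)
    simpa [charVec_dotProduct] using h
  · have h : (-1 : ℝ) ≤ (-charVec {a}) ⬝ᵥ x := hx (.leOne a)
    simpa [charVec_dotProduct] using h

lemma exists_rowMatrix_eq_intCast (i : D.Row S T) (a : A) :
    ∃ n : ℤ, D.rowMatrix S T i a = n := by
  have h : ∀ C : Finset A, charVec C a = ((if a ∈ C then 1 else 0 : ℤ) : ℝ) := fun C => by
    simp [charVec]
  rcases i with v | v | C | a' | a'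
  · exact ⟨_, h _⟩
  · exact ⟨_, h _⟩
  · exact ⟨_, h _⟩
  · exact ⟨_, h _⟩
  · exact ⟨-_, by rw [ArcDigraph.rowMatrix, Pi.neg_apply, h, Int.cast_neg]⟩

theorem bBibranchingPolytope_eq (hST : Disjoint S T) (hcover : S ∪ T = Finset.univ)
    (hb : ∀ v, 0 < b v) :
    D.bBibranchingPolytope S T b = solutionSet (D.rowMatrix S T) (D.rowRhs S T b) := by
  apply Set.Subset.antisymm
  · refine convexHull_min ?_ (convex_solutionSet _ _)
    rintro x ⟨B, hB, rfl⟩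
    exact (charVec_mem_solutionSet_iff D hST hcover B).2 hB
  · have hcomp : IsCompact (solutionSet (D.rowMatrix S T) (D.rowRhs S T b)) :=
      isCompact_Icc.of_isClosed_subset (isClosed_solutionSet _ _) (solutionSet_subset_Icc D)
    have hfin : {x | ∃ B : Finset A, D.IsBBibranching S T b B ∧ x = charVec B}.Finite :=
      (Set.finite_range fun B : Finset A => (charVec B : A → ℝ)).subset (by
        rintro x ⟨B, -, rfl⟩; exact ⟨B, rfl⟩)
    -- The closure in Krein–Milman is harmless: there are finitely many characteristic vectors, so
    -- their hull is closed.
    rw [← closure_convexHull_extremePoints hcomp (convex_solutionSet _ _)]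
    refine closure_minimal (convexHull_mono fun x hx => ?_) (hfin.isClosed_convexHull ℝ)
    have hint := (isTDI_rowMatrix D hST hcover hb).extremePoints_integral
      (exists_rowMatrix_eq_intCast D) (exists_rowRhs_eq_intCast D) hx
    have hx01 := solutionSet_subset_Icc D hx.1
    have hxB : x = charVec (Finset.univ.filter fun a => x a = 1) := by
      ext a
      obtain ⟨n, hn⟩ := hint a
      have h0 : (0 : ℝ) ≤ n := hn ▸ hx01.1 a
      have h1 : (n : ℝ) ≤ 1 := hn ▸ hx01.2 a
      have h0' : 0 ≤ n := by exact_mod_cast h0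
      have h1' : n ≤ 1 := by exact_mod_cast h1
      obtain rfl | rfl : n = 0 ∨ n = 1 := by omega
      · simp [charVec, hn]
      · simp [charVec, hn]
    exact ⟨_, (charVec_mem_solutionSet_iff D hST hcover _).1 (hxB ▸ hx.1), hxB⟩

end Polytope

theorem corollary2 {V A : Type*} [Fintype V] [DecidableEq V] [Fintype A] [DecidableEq A]
    (D : ArcDigraph V A) (S T : Finset V) (hS : S.Nonempty) (hT : T.Nonempty)
    (hST : Disjoint S T) (hcover : S ∪ T = Finset.univ)
    (b : V → ℕ) (hb : ∀ v, 0 < b v) :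
    IsTDI (D.rowMatrix S T) (D.rowRhs S T b) ∧
      D.bBibranchingPolytope S T b = solutionSet (D.rowMatrix S T) (D.rowRhs S T b) :=
  ⟨isTDI_rowMatrix D hST hcover hb, bBibranchingPolytope_eq D hST hcover hb⟩
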